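/- Let $E \neq \{0\}$ be a complex Banach space with open unit ball $B_E$, and let $\mathcal{H}^\infty(B_E)$ be the space of bounded holomorphic functions $f : B_E \to \mathbb{C}$ with the supremum norm. Let $G^\infty(E)$ be Mujica's predual of $\mathcal{H}^\infty(B_E)$, that is, the Banach space of all $\varphi \in \mathcal{H}^\infty(B_E)^*$ whose restriction to the unit ball of $\mathcal{H}^\infty(B_E)$ is continuous for the compact-open topology, with the norm of $\mathcal{H}^\infty(B_E)^*$. A unit vector $x$ of a complex Banach space $X$ is called strongly exposed if there is a unit vector $x^* \in X^*$ with $x^*(x) = 1$ such that every sequence $(x_n)$ in the open unit ball $B_X$ with $\operatorname{Re} x^*(x_n) \to 1$ converges to $x$ in norm. A Banach space $X$ has the Radon–Nikodým property if, for every finite measure space $(\Omega, \Sigma, \mu)$ and every countably additive vector measure $m : \Sigma \to X$ of bounded variation that is absolutely continuous with respect to $\mu$, there is a Bochner integrable $g : \Omega \to X$ with $m(A) = \int_A g \, d\mu$ for all $A \in \Sigma$. Then $G^\infty(E)$ has no strongly exposed points. Moreover, $G^\infty(E)$ fails the Radon–Nikodým property. -/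

import Mathlib

open Filter Topology Metric MeasureTheory
open scoped BoundedContinuousFunction

noncomputable section

/-- The bounded holomorphic functions on the open unit ball `B_E` of a complex normed space `E`,
as a subspace of the bounded continuous functions on `B_E`. Holomorphic means complex Fréchet
differentiable at every point of `B_E`; as differentiability is a notion for functions on `E`,
the function is extended by `0` outside `B_E`. -/
def boundedHolomorphic (E : Type*) [NormedAddCommGroup E] [NormedSpace ℂ E] :
    Submodule ℂ (↥(ball (0 : E) 1) →ᵇ ℂ) where
  carrier := {f | DifferentiableOn ℂ
    (Function.extend (Subtype.val : ↥(ball (0 : E) 1) → E) f 0) (ball (0 : E) 1)}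
  zero_mem' := by
    refine (differentiableOn_const (c := (0 : ℂ))).congr fun x hx => ?_
    exact Subtype.val_injective.extend_apply (0 : ↥(ball (0 : E) 1) →ᵇ ℂ) 0 ⟨x, hx⟩
  add_mem' := by
    intro f g hf hg
    refine (DifferentiableOn.add hf hg).congr fun x hx => ?_
    have key (h : ↥(ball (0 : E) 1) → ℂ) :
        Function.extend Subtype.val h 0 x = h ⟨x, hx⟩ :=
      Subtype.val_injective.extend_apply h 0 ⟨x, hx⟩
    simp [key]
  smul_mem' := by
    intro c f hf
    refine (DifferentiableOn.const_smul hf c).congr fun x hx => ?_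
    have key (h : ↥(ball (0 : E) 1) → ℂ) :
        Function.extend Subtype.val h 0 x = h ⟨x, hx⟩ :=
      Subtype.val_injective.extend_apply h 0 ⟨x, hx⟩
    simp [key]

/-- The space `H^∞(B_E)` of bounded holomorphic functions on `B_E`, with the supremum norm. -/
def HInfty (E : Type*) [NormedAddCommGroup E] [NormedSpace ℂ E] : Type _ :=
  ↥(boundedHolomorphic E)

instance (E : Type*) [NormedAddCommGroup E] [NormedSpace ℂ E] : NormedAddCommGroup (HInfty E) :=
  inferInstanceAs (NormedAddCommGroup ↥(boundedHolomorphic E))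

instance (E : Type*) [NormedAddCommGroup E] [NormedSpace ℂ E] : NormedSpace ℂ (HInfty E) :=
  inferInstanceAs (NormedSpace ℂ ↥(boundedHolomorphic E))

/-- A bounded holomorphic function as a continuous function on `B_E`. -/
def HInfty.toContinuousMap {E : Type*} [NormedAddCommGroup E] [NormedSpace ℂ E] (f : HInfty E) :
    C(↥(ball (0 : E) 1), ℂ) :=
  f.1.toContinuousMap

/-- The compact-open topology `τ_c` on `H^∞(B_E)`: uniform convergence on the compact subsets
of `B_E`. -/
@[reducible]
def compactOpenTopology (E : Type*) [NormedAddCommGroup E] [NormedSpace ℂ E] :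
    TopologicalSpace (HInfty E) :=
  TopologicalSpace.induced HInfty.toContinuousMap ContinuousMap.compactOpen

/-- Mujica's predual `G^∞(E)` of `H^∞(B_E)`: the space of those `φ` in the dual `H^∞(B_E)^*` whose
restriction to the unit ball of `H^∞(B_E)` is continuous for the compact-open topology, with the
norm of `H^∞(B_E)^*`. -/
def GInfty (E : Type*) [NormedAddCommGroup E] [NormedSpace ℂ E] :
    Submodule ℂ (StrongDual ℂ (HInfty E)) where
  carrier := {φ | @ContinuousOn _ _ (compactOpenTopology E) _ (fun f => φ f)
    (ball (0 : HInfty E) 1)}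
  zero_mem' := @continuousOn_const _ _ (compactOpenTopology E) _ _ _
  add_mem' := fun {_ _} hφ hψ => @ContinuousOn.add _ _ _ _ _ (compactOpenTopology E) _ _ _ hφ hψ
  smul_mem' := fun c _ hφ =>
    @ContinuousOn.const_smul _ _ _ _ _ _ (compactOpenTopology E) _ _ hφ c

theorem isClosed_GInfty (E : Type*) [NormedAddCommGroup E] [NormedSpace ℂ E] :
    IsClosed (GInfty E : Set (StrongDual ℂ (HInfty E))) := by
  rw [← closure_subset_iff_isClosed]
  intro φ hφ
  obtain ⟨u, hu, hlim⟩ := mem_closure_iff_seq_limit.1 hφ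
  have key : TendstoUniformlyOn (fun n f => u n f) (fun f => φ f) atTop
      (ball (0 : HInfty E) 1) := by
    rw [Metric.tendstoUniformlyOn_iff]
    intro ε hε
    filter_upwards [(tendsto_iff_norm_sub_tendsto_zero.1 hlim).eventually (gt_mem_nhds hε)]
      with n hn f hf
    rw [dist_comm, dist_eq_norm]
    calc ‖u n f - φ f‖ = ‖(u n - φ) f‖ := rfl
      _ ≤ ‖u n - φ‖ * ‖f‖ := (u n - φ).le_opNorm f
      _ ≤ ‖u n - φ‖ := mul_le_of_le_one_right (norm_nonneg _) (mem_ball_zero_iff.1 hf).le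
      _ < ε := hn
  exact @TendstoUniformlyOn.continuousOn _ _ _ (compactOpenTopology E) _ _ _ _ _ key
    (Filter.Frequently.of_forall hu)

/-- `G^∞(E)` is a Banach space. -/
instance (E : Type*) [NormedAddCommGroup E] [NormedSpace ℂ E] : CompleteSpace (GInfty E) :=
  (isClosed_GInfty E).completeSpace_coe

/-- A unit vector `x` of a complex Banach space `X` is strongly exposed if there is a unit vector
`f` of `X^*` with `f x = 1` such that every sequence `(u n)` in the open unit ball of `X` with
`Re f (u n) → 1` converges to `x` in norm. (The closed ball gives the same notion, as one sees by
multiplying the `n`-th term by `1 - 1 / (n + 1)`.) -/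
def IsStronglyExposedPoint {X : Type*} [NormedAddCommGroup X] [NormedSpace ℂ X] (x : X) : Prop :=
  ‖x‖ = 1 ∧ ∃ f : StrongDual ℂ X, ‖f‖ = 1 ∧ f x = 1 ∧
    ∀ u : ℕ → X, (∀ n, u n ∈ ball (0 : X) 1) →
      Tendsto (fun n => (f (u n)).re) atTop (𝓝 1) → Tendsto u atTop (𝓝 x)

/-- A Banach space `X` has the Radon–Nikodým property if, for every finite measure space
`(Ω, μ)`, every countably additive `X`-valued vector measure `m` on `Ω` of bounded variation that
is absolutely continuous with respect to `μ` has a Bochner integrable density with respect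
to `μ`. (It is enough to consider Lebesgue measure on `[0, 1]`, so measure spaces `Ω : Type` give
the same property as measure spaces in any other universe.) -/
def HasRadonNikodymProperty (X : Type*) [NormedAddCommGroup X] [NormedSpace ℝ X]
    [CompleteSpace X] : Prop :=
  ∀ (Ω : Type) [MeasurableSpace Ω] (μ : Measure Ω) [IsFiniteMeasure μ] (m : VectorMeasure Ω X),
    m.variation Set.univ < ⊤ →
    VectorMeasure.AbsolutelyContinuous m μ.toENNRealVectorMeasure →
    ∃ g : Ω → X, Integrable g μ ∧ ∀ A : Set Ω, MeasurableSet A → m A = ∫ ω in A, g ω ∂μ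

end

noncomputable section

/-! Both halves rest on one fact: if `|f| < 1` on the ball, then `f ^ k → 0` in the compact-open
topology, so every `φ` in `G^∞(E)` satisfies `φ (f ^ k) → 0` (`tendsto_apply_npow`).

Strongly exposed points: an exposing functional is evaluation at some `f` in `H^∞(B_E)`
(`exists_eq_apply`), and `|f|` has supremum 1. Whenever `|f (x n)| → 1`, the evaluations at `x n`,
rotated to make `f (x n)` positive and slightly shrunk, must converge in norm to `φ`. If `|f|`
reaches 1, the maximum principle makes `f` constant, so the same multiple of every evaluation equals
`φ`, although evaluations separate points. Otherwise `φ (f ^ k)` is a limit of numbers of modulus `ρ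
n * |f (x n)| ^ k`, hence has modulus 1 for all `k`, against the fact above.

Radon–Nikodým property: let `g` be a norm-one functional with `g v = 1`. Integrating boundary values
along the circle through `v` gives a contraction from `L¹` of the circle to `G^∞(E)` sending `h` to
a functional with value `∫ e^{int} h` at `g ^ n` (`exists_boundaryFunctional`). A density `d` would
satisfy `d t (g ^ n) = e^{int}` for all `n` and almost every `t`, again of modulus 1. -/

theorem ball_one_sub_norm_subset {E : Type*} [SeminormedAddCommGroup E] (x : E) : ball x (1 - ‖x‖) ⊆ ball (0 : E) 1 := by
  intro y hy
  rw [mem_ball, dist_eq_norm] at hy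
  rw [mem_ball_zero_iff]
  linarith [norm_le_norm_add_norm_sub x y, norm_sub_rev x y]

/-! ### Elements of `H^∞(B_E)` as functions, and their powers -/

namespace HInfty

variable {E : Type*} [NormedAddCommGroup E] [NormedSpace ℂ E]

/-- A bounded holomorphic function on `B_E`, extended by `0` to all of `E`. -/
def toFun (f : HInfty E) : E → ℂ :=
  Function.extend (Subtype.val : ↥(ball (0 : E) 1) → E) f.1 0

theorem toFun_coe (f : HInfty E) (x : ↥(ball (0 : E) 1)) : f.toFun x = f.1 x :=
  Subtype.val_injective.extend_apply _ _ x

theorem toContinuousMap_apply (f : HInfty E) (x : ↥(ball (0 : E) 1)) :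
    f.toContinuousMap x = f.toFun x :=
  (toFun_coe f x).symm

theorem toFun_of_notMem (f : HInfty E) {x : E} (hx : x ∉ ball (0 : E) 1) : f.toFun x = 0 :=
  Function.extend_apply' _ _ _ (by rintro ⟨y, rfl⟩; exact hx y.2)

theorem differentiableOn_toFun (f : HInfty E) : DifferentiableOn ℂ f.toFun (ball (0 : E) 1) :=
  f.2

theorem norm_toFun_le (f : HInfty E) (x : E) : ‖f.toFun x‖ ≤ ‖f‖ := by
  by_cases hx : x ∈ ball (0 : E) 1
  · rw [toFun_coe f ⟨x, hx⟩]
    exact f.1.norm_coe_le_norm ⟨x, hx⟩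
  · rw [toFun_of_notMem f hx, norm_zero]
    exact norm_nonneg _

theorem norm_le_of_forall (f : HInfty E) {C : ℝ} (hC : 0 ≤ C)
    (h : ∀ x ∈ ball (0 : E) 1, ‖f.toFun x‖ ≤ C) : ‖f‖ ≤ C :=
  (BoundedContinuousFunction.norm_le hC).2 fun x =>
    (congrArg norm (toFun_coe f x)).symm.trans_le (h x x.2)

@[simp] theorem toFun_add (f g : HInfty E) (x : E) :
    (f + g).toFun x = f.toFun x + g.toFun x := by
  by_cases hx : x ∈ ball (0 : E) 1
  · simp only [toFun_coe _ ⟨x, hx⟩]; rfl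
  · simp [toFun_of_notMem _ hx]

@[simp] theorem toFun_smul (c : ℂ) (f : HInfty E) (x : E) :
    (c • f).toFun x = c * f.toFun x := by
  by_cases hx : x ∈ ball (0 : E) 1
  · simp only [toFun_coe _ ⟨x, hx⟩]; rfl
  · simp [toFun_of_notMem _ hx]

@[simp] theorem toFun_zero (x : E) : (0 : HInfty E).toFun x = 0 := by
  simpa using toFun_smul (0 : ℂ) (0 : HInfty E) x

/-- The element of `H^∞(B_E)` given by a bounded holomorphic function on `B_E`. -/
def ofFun (f : E → ℂ) (hd : DifferentiableOn ℂ f (ball (0 : E) 1)) (C : ℝ)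
    (hC : ∀ x ∈ ball (0 : E) 1, ‖f x‖ ≤ C) : HInfty E :=
  ⟨BoundedContinuousFunction.ofNormedAddCommGroup (fun x : ↥(ball (0 : E) 1) => f x)
    hd.continuousOn.domRestrict C fun x => hC x x.2,
    hd.congr fun x hx => Subtype.val_injective.extend_apply _ _ (⟨x, hx⟩ : ↥(ball (0 : E) 1))⟩

theorem toFun_ofFun {f : E → ℂ} {hd : DifferentiableOn ℂ f (ball (0 : E) 1)} {C : ℝ}
    {hC : ∀ x ∈ ball (0 : E) 1, ‖f x‖ ≤ C} {x : E} (hx : x ∈ ball (0 : E) 1) :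
    (ofFun f hd C hC).toFun x = f x :=
  Subtype.val_injective.extend_apply _ _ (⟨x, hx⟩ : ↥(ball (0 : E) 1))

/-- The powers of an element of `H^∞(B_E)`. -/
def npow (f : HInfty E) (k : ℕ) : HInfty E :=
  ofFun (fun x => f.toFun x ^ k) (f.differentiableOn_toFun.pow k) (‖f‖ ^ k) fun x _ => by
    rw [norm_pow]; gcongr; exact f.norm_toFun_le x

theorem toFun_npow (f : HInfty E) (k : ℕ) {x : E} (hx : x ∈ ball (0 : E) 1) :
    (f.npow k).toFun x = f.toFun x ^ k :=
  toFun_ofFun hx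

theorem norm_npow_le_one {f : HInfty E} (hf : ‖f‖ ≤ 1) (k : ℕ) : ‖f.npow k‖ ≤ 1 :=
  norm_le_of_forall _ zero_le_one fun x hx => by
    rw [toFun_npow f k hx, norm_pow]
    exact pow_le_one₀ (norm_nonneg _) ((f.norm_toFun_le x).trans hf)

/-! ### Point evaluations and compact-open convergence -/

/-- Evaluation at a point of `B_E`, as a functional on `H^∞(B_E)`. -/
def pointEval (x : E) : StrongDual ℂ (HInfty E) :=
  LinearMap.mkContinuous
    { toFun := fun f => f.toFun x
      map_add' := fun f g => toFun_add f g x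
      map_smul' := fun c f => toFun_smul c f x } 1
    fun f => by simpa using f.norm_toFun_le x

@[simp] theorem pointEval_apply (x : E) (f : HInfty E) : pointEval x f = f.toFun x := rfl

theorem norm_pointEval_le (x : E) : ‖pointEval x‖ ≤ 1 :=
  LinearMap.mkContinuous_norm_le _ zero_le_one _

theorem continuous_toFun_compactOpen {x : E} (hx : x ∈ ball (0 : E) 1) :
    @Continuous _ _ (compactOpenTopology E) _ (fun f : HInfty E => f.toFun x) := by
  have h := (continuous_eval_const (F := C(↥(ball (0 : E) 1), ℂ))
    (⟨x, hx⟩ : ↥(ball (0 : E) 1)))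
  have h2 := @Continuous.comp _ _ _ (compactOpenTopology E) _ _ _ _ h continuous_induced_dom
  exact funext (fun f => toContinuousMap_apply f ⟨x, hx⟩) ▸ h2

theorem pointEval_mem_GInfty (x : E) : pointEval x ∈ GInfty E := by
  by_cases hx : x ∈ ball (0 : E) 1
  · exact @Continuous.continuousOn _ _ (compactOpenTopology E) _ _ _
      (continuous_toFun_compactOpen hx)
  · have : pointEval x = (0 : StrongDual ℂ (HInfty E)) := by
      ext f; simp [toFun_of_notMem f hx]
    rw [this]
    exact zero_mem _

/-- Locally uniform convergence implies compact-open convergence, even where the ball is not locally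
compact. The filter is arbitrary because the density argument uses a net indexed by finite sets. -/
theorem tendsto_apply_zero {ι : Type*} {l : Filter ι} {φ : StrongDual ℂ (HInfty E)}
    (hφ : φ ∈ GInfty E) {f : ι → HInfty E} (hf : ∀ i, f i ∈ ball (0 : HInfty E) 1)
    (h : ∀ x ∈ ball (0 : E) 1, ∀ ε > 0, ∃ t ∈ 𝓝 x, ∀ᶠ i in l, ∀ y ∈ t, ‖(f i).toFun y‖ < ε) :
    Tendsto (fun i => φ (f i)) l (𝓝 0) := by
  have hc : Tendsto (fun i => (f i).toContinuousMap) l (𝓝 (0 : HInfty E).toContinuousMap) := by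
    apply ContinuousMap.tendsto_of_tendstoLocallyUniformly
    rw [Metric.tendstoLocallyUniformly_iff]
    intro ε hε x
    obtain ⟨t, ht, hi⟩ := h x x.2 ε hε
    refine ⟨Subtype.val ⁻¹' t, continuous_subtype_val.continuousAt.preimage_mem_nhds ht, ?_⟩
    filter_upwards [hi] with i hi y hy
    rw [toContinuousMap_apply, toContinuousMap_apply, toFun_zero, dist_zero_left]
    exact hi y hy
  have hn : Tendsto f l (@nhds _ (compactOpenTopology E) 0) := by
    rw [nhds_induced, tendsto_comap_iff]
    exact hc
  have h0 : (0 : HInfty E) ∈ ball (0 : HInfty E) 1 := mem_ball_self zero_lt_one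
  have h1 : Tendsto (fun g => φ g) (@nhdsWithin _ (compactOpenTopology E) 0 (ball 0 1))
      (𝓝 (φ 0)) := hφ 0 h0
  rw [map_zero] at h1
  refine h1.comp ?_
  exact tendsto_inf.2 ⟨hn, tendsto_principal.2 (Eventually.of_forall hf)⟩

theorem tendsto_apply_npow {φ : StrongDual ℂ (HInfty E)} (hφ : φ ∈ GInfty E) {f : HInfty E}
    (hf : ∀ x ∈ ball (0 : E) 1, ‖f.toFun x‖ < 1) :
    Tendsto (fun k => φ (f.npow k)) atTop (𝓝 0) := by
  have hf1 : ‖f‖ ≤ 1 := f.norm_le_of_forall zero_le_one fun x hx => (hf x hx).le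
  -- Continuity is only given on the open unit ball, while `f.npow k` may have norm 1; hence the
  -- factor 1/2.
  have key : Tendsto (fun k => φ ((2⁻¹ : ℂ) • f.npow k)) atTop (𝓝 0) := by
    refine tendsto_apply_zero hφ (fun k => ?_) fun x hx ε hε => ?_
    · rw [mem_ball_zero_iff, norm_smul, norm_inv, Complex.norm_ofNat]
      linarith [norm_npow_le_one hf1 k]
    · obtain ⟨ρ, hρ, hρ1⟩ := exists_between (hf x hx)
      have hx' : ball (0 : E) 1 ∈ 𝓝 x := isOpen_ball.mem_nhds hx
      have hc : ContinuousAt f.toFun x := f.differentiableOn_toFun.continuousOn.continuousAt hx'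
      refine ⟨_, inter_mem hx' (hc.norm.preimage_mem_nhds (Iio_mem_nhds hρ)), ?_⟩
      have hρ0 : 0 ≤ ρ := (norm_nonneg _).trans hρ.le
      filter_upwards [(tendsto_pow_atTop_nhds_zero_of_lt_one hρ0 hρ1).eventually (gt_mem_nhds hε)]
        with k hk y hy
      rw [toFun_smul, toFun_npow f k hy.1, norm_mul, norm_inv, Complex.norm_ofNat, norm_pow]
      have : ‖f.toFun y‖ ^ k ≤ ρ ^ k := pow_le_pow_left₀ (norm_nonneg _) (le_of_lt hy.2) k
      have : 0 ≤ ‖f.toFun y‖ ^ k := by positivity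
      linarith
  have := key.const_mul 2
  simpa using this

/-! ### Schwarz estimates and norm differentiability of evaluation -/

theorem mapsTo_closedBall (f : HInfty E) (x : E) (s : Set E) :
    Set.MapsTo f.toFun s (closedBall (f.toFun x) (2 * ‖f‖)) := by
  intro y _
  rw [mem_closedBall, dist_eq_norm]
  linarith [norm_sub_le (f.toFun y) (f.toFun x), f.norm_toFun_le x, f.norm_toFun_le y]

/-- Schwarz lemma on the ball about `x`. The bound is uniform over the unit ball of `H^∞(B_E)`, so
vanishing at `x` forces uniform smallness near `x`. -/
theorem norm_toFun_sub_le (f : HInfty E) {x y : E} (hy : y ∈ ball x (1 - ‖x‖)) :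
    ‖f.toFun y - f.toFun x‖ ≤ 2 * ‖f‖ / (1 - ‖x‖) * ‖y - x‖ := by
  rw [← dist_eq_norm, ← dist_eq_norm]
  exact Complex.dist_le_div_mul_dist_of_mapsTo_ball
    (f.differentiableOn_toFun.mono (ball_one_sub_norm_subset x)) (f.mapsTo_closedBall x _) hy

theorem norm_fderiv_toFun_le (f : HInfty E) {x : E} (hx : x ∈ ball (0 : E) 1) :
    ‖fderiv ℂ f.toFun x‖ ≤ 2 * ‖f‖ / (1 - ‖x‖) :=
  Complex.norm_fderiv_le_div_of_mapsTo_ball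
    (f.differentiableOn_toFun.mono (ball_one_sub_norm_subset x)) (f.mapsTo_closedBall x _)
    (sub_pos.2 (mem_ball_zero_iff.1 hx))

theorem differentiableAt_toFun (f : HInfty E) {x : E} (hx : x ∈ ball (0 : E) 1) :
    DifferentiableAt ℂ f.toFun x :=
  f.differentiableOn_toFun.differentiableAt (isOpen_ball.mem_nhds hx)

/-- The quadratic error bound for the linear approximation of a bounded holomorphic function. -/
theorem norm_toFun_sub_sub_fderiv_le (f : HInfty E) {x y : E} (hx : x ∈ ball (0 : E) 1)
    (hy : y ∈ ball x (1 - ‖x‖)) :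
    ‖f.toFun y - f.toFun x - fderiv ℂ f.toFun x (y - x)‖
      ≤ 4 / (1 - ‖x‖) ^ 2 * ‖y - x‖ ^ 2 * ‖f‖ := by
  have hr : 0 < 1 - ‖x‖ := sub_pos.2 (mem_ball_zero_iff.1 hx)
  set L := fderiv ℂ f.toFun x with hL
  -- Removing the linear part leaves `F - F x` of order `o(‖w - x‖)`, so the higher-order Schwarz
  -- lemma gives a quadratic bound.
  set F : E → ℂ := fun w => f.toFun w - L (w - x) with hF
  have hFx : F x = f.toFun x := by simp [hF]
  have hd : DifferentiableOn ℂ F (ball x (1 - ‖x‖)) :=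
    (f.differentiableOn_toFun.mono (ball_one_sub_norm_subset x)).sub
      (L.differentiable.comp (differentiable_id.sub_const x)).differentiableOn
  have hmaps : Set.MapsTo F (ball x (1 - ‖x‖)) (closedBall (F x) (4 * ‖f‖)) := by
    intro w hw
    have h1 := f.mapsTo_closedBall x _ hw
    rw [mem_closedBall, dist_eq_norm] at h1 ⊢
    rw [mem_ball, dist_eq_norm] at hw
    have h2 : ‖L (w - x)‖ ≤ 2 * ‖f‖ := calc
      ‖L (w - x)‖ ≤ ‖L‖ * ‖w - x‖ := L.le_opNorm _
      _ ≤ 2 * ‖f‖ / (1 - ‖x‖) * (1 - ‖x‖) := by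
        gcongr
        exact f.norm_fderiv_toFun_le hx
      _ = 2 * ‖f‖ := div_mul_cancel₀ _ hr.ne'
    have h3 : F w - F x = (f.toFun w - f.toFun x) - L (w - x) := by rw [hFx]; ring
    rw [h3]
    linarith [norm_sub_le (f.toFun w - f.toFun x) (L (w - x))]
  have ho : (F · - F x) =o[𝓝 x] fun w => ‖w - x‖ ^ 1 := by
    have := (f.differentiableAt_toFun hx).hasFDerivAt.isLittleO
    simp only [pow_one]
    refine this.norm_right.congr_left fun w => ?_
    rw [hFx]; simp only [hF]; ring
  have := Complex.dist_le_mul_div_pow_of_mapsTo_ball_of_isLittleO hd hmaps ho hy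
  rw [dist_eq_norm, dist_eq_norm, hFx] at this
  calc _ = ‖F y - f.toFun x‖ := by congr 1; simp only [hF]; ring
    _ ≤ _ := this
    _ = _ := by rw [one_add_one_eq_two, div_pow]; ring

/-- The derivative of `pointEval`. -/
def pointEvalDeriv (x : E) (hx : x ∈ ball (0 : E) 1) : E →L[ℂ] StrongDual ℂ (HInfty E) :=
  LinearMap.mkContinuous₂
    (LinearMap.mk₂ ℂ (fun h (f : HInfty E) => fderiv ℂ f.toFun x h)
      (fun h k f => map_add _ h k) (fun c h f => map_smul _ c h)
      (fun h f g => by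
        have : (f + g).toFun = f.toFun + g.toFun := funext (toFun_add f g)
        rw [this, fderiv_add (f.differentiableAt_toFun hx) (g.differentiableAt_toFun hx)]
        rfl)
      (fun c h f => by
        have : (c • f).toFun = c • f.toFun := funext (toFun_smul c f)
        rw [this, fderiv_const_smul (f.differentiableAt_toFun hx)]
        rfl))
    (2 / (1 - ‖x‖)) fun h f => by
      refine ((fderiv ℂ f.toFun x).le_opNorm h).trans ?_
      calc _ ≤ 2 * ‖f‖ / (1 - ‖x‖) * ‖h‖ := by
            gcongr; exact f.norm_fderiv_toFun_le hx
        _ = _ := by ring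

/-- The quadratic error is proportional to `‖f‖`, hence is an operator-norm bound. -/
theorem hasFDerivAt_pointEval {x : E} (hx : x ∈ ball (0 : E) 1) :
    HasFDerivAt (pointEval : E → StrongDual ℂ (HInfty E)) (pointEvalDeriv x hx) x := by
  have hr : 0 < 1 - ‖x‖ := sub_pos.2 (mem_ball_zero_iff.1 hx)
  refine HasFDerivAt.of_isLittleO ?_
  have hO : (fun y => pointEval y - pointEval x - pointEvalDeriv x hx (y - x)) =O[𝓝 x]
      fun y => ‖y - x‖ ^ 2 := by
    refine Asymptotics.IsBigO.of_bound (4 / (1 - ‖x‖) ^ 2) ?_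
    filter_upwards [ball_mem_nhds x hr] with y hy
    refine ContinuousLinearMap.opNorm_le_bound _ (by positivity) fun f => ?_
    rw [norm_pow, norm_norm]
    exact f.norm_toFun_sub_sub_fderiv_le hx hy
  refine hO.trans_isLittleO ?_
  have h0 : Tendsto (fun y : E => y - x) (𝓝 x) (𝓝 0) := by
    simpa using (continuous_id.sub continuous_const).tendsto (f := fun y : E => y - x) x
  exact (Asymptotics.isLittleO_norm_pow_id one_lt_two).comp_tendsto h0

/-! ### Density of evaluations and the dual of `G^∞(E)` -/

/-- The evaluations at points of `B_E` have dense span in `G^∞(E)`. -/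
theorem exists_mem_span_pointEval_norm_sub_le {φ : StrongDual ℂ (HInfty E)} (hφ : φ ∈ GInfty E)
    {ε : ℝ} (hε : 0 < ε) :
    ∃ χ ∈ Submodule.span ℂ (Set.range (pointEval : E → StrongDual ℂ (HInfty E))),
      ‖φ - χ‖ ≤ ε := by
  -- Otherwise each finite `s` has a bad function vanishing on it; by the Schwarz bound this net
  -- tends to 0 locally uniformly, contradicting continuity of `φ`.
  have hs : ∃ s : Finset E, ∀ f : HInfty E, ‖f‖ < 1 → (∀ x ∈ s, f.toFun x = 0) → ‖φ f‖ < ε := by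
    by_contra! h
    choose f hf1 hf0 hfε using h
    have : Tendsto (fun s => φ (f s)) atTop (𝓝 0) := by
      refine tendsto_apply_zero hφ (fun s => mem_ball_zero_iff.2 (hf1 s)) fun x hx δ hδ => ?_
      have hr : 0 < 1 - ‖x‖ := sub_pos.2 (mem_ball_zero_iff.1 hx)
      refine ⟨ball x (min (1 - ‖x‖) (δ * (1 - ‖x‖) / 2)), ball_mem_nhds x (by positivity), ?_⟩
      filter_upwards [eventually_ge_atTop {x}] with s hs y hy
      have hy1 : y ∈ ball x (1 - ‖x‖) := ball_subset_ball (min_le_left _ _) hy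
      have hy2 : ‖y - x‖ < δ * (1 - ‖x‖) / 2 := by
        rw [← dist_eq_norm]; exact ball_subset_ball (min_le_right _ _) hy
      have h0 : (f s).toFun x = 0 := hf0 s x (hs (Finset.mem_singleton_self x))
      have h1 := (f s).norm_toFun_sub_le hy1
      rw [h0, sub_zero] at h1
      calc _ ≤ _ := h1
        _ ≤ 2 * 1 / (1 - ‖x‖) * ‖y - x‖ := by gcongr; exact (hf1 s).le
        _ < 2 * 1 / (1 - ‖x‖) * (δ * (1 - ‖x‖) / 2) := by gcongr
        _ = δ := by field_simp
    obtain ⟨s, hs⟩ := (this.norm.eventually (gt_mem_nhds (by simpa using hε))).exists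
    exact (hfε s).not_gt hs
  obtain ⟨s, hs⟩ := hs
  set N : Submodule ℂ (HInfty E) :=
    ⨅ x : s, LinearMap.ker (pointEval (x : E)).toLinearMap with hN
  have hφN : ‖φ.comp N.subtypeL‖ ≤ ε := by
    refine ContinuousLinearMap.opNorm_le_bound _ hε.le fun f => ?_
    refine le_of_forall_pos_le_add fun δ hδ => ?_
    -- Slightly above `‖f‖`, so that `c⁻¹ • f` lies in the open ball; `ε * c = ε * ‖f‖ + δ`.
    set c : ℝ := ‖f‖ + δ / ε with hc
    have hc0 : 0 < c := by positivity
    have h1 := hs ((c⁻¹ : ℂ) • (f : HInfty E)) ?_ ?_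
    · rw [map_smul, norm_smul, norm_inv, Complex.norm_real, Real.norm_of_nonneg hc0.le,
        inv_mul_lt_iff₀ hc0] at h1
      refine h1.le.trans_eq ?_
      rw [hc]; field_simp
    · rw [norm_smul, norm_inv, Complex.norm_real, Real.norm_of_nonneg hc0.le,
        inv_mul_lt_iff₀ hc0, mul_one, hc]
      have : 0 < δ / ε := by positivity
      exact lt_add_of_pos_right _ this
    · intro x hx
      have : (f : HInfty E).toFun x = 0 := by
        have := (Submodule.mem_iInf _).1 f.2 ⟨x, hx⟩
        exact this
      rw [toFun_smul, this, mul_zero]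
  -- The Hahn–Banach extension `ψ` is small, and `φ - ψ` vanishes on the common kernel of finitely
  -- many evaluations, hence is a combination of them.
  obtain ⟨ψ, hψN, hψ⟩ := exists_extension_norm_eq N (φ.comp N.subtypeL)
  refine ⟨φ - ψ, ?_, by rw [sub_sub_cancel, hψ]; exact hφN⟩
  have hker : ⨅ x : s, LinearMap.ker (pointEval (x : E)).toLinearMap
      ≤ LinearMap.ker (φ - ψ).toLinearMap := by
    intro f hf
    have : ψ f = φ f := hψN ⟨f, hf⟩
    change φ f - ψ f = 0
    rw [this, sub_self]
  obtain ⟨c, hc⟩ := (Submodule.mem_span_range_iff_exists_fun ℂ).1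
    (mem_span_of_iInf_ker_le_ker hker)
  have : φ - ψ = ∑ x : s, c x • pointEval (x : E) := by
    ext f
    have := LinearMap.congr_fun hc f
    simpa using this.symm
  rw [this]
  exact Submodule.sum_mem _ fun x _ => Submodule.smul_mem _ _ (Submodule.subset_span ⟨_, rfl⟩)

/-- Every functional on `G^∞(E)` is the evaluation at an element of `H^∞(B_E)`. -/
theorem exists_eq_apply (F : StrongDual ℂ (GInfty E)) :
    ∃ f : HInfty E, ∀ ψ : GInfty E, F ψ = (ψ : StrongDual ℂ (HInfty E)) f := by
  obtain ⟨G, hG, -⟩ := exists_extension_norm_eq (GInfty E) F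
  -- The representing function has to be `x ↦ G (pointEval x)`; it is holomorphic because evaluation
  -- is norm differentiable.
  have hd : DifferentiableOn ℂ (fun x : E => G (pointEval x)) (ball 0 1) := fun x hx =>
    (G.differentiableAt.comp x (hasFDerivAt_pointEval hx).differentiableAt).differentiableWithinAt
  set f : HInfty E := ofFun _ hd ‖G‖ fun x _ =>
    (G.le_opNorm _).trans (mul_le_of_le_one_right (norm_nonneg _) (norm_pointEval_le x))
  refine ⟨f, fun ψ => ?_⟩
  rw [← hG]
  set L : StrongDual ℂ (StrongDual ℂ (HInfty E)) :=
    G - ContinuousLinearMap.apply ℂ ℂ f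
  have hL : Submodule.span ℂ (Set.range (pointEval : E → StrongDual ℂ (HInfty E)))
      ≤ LinearMap.ker L.toLinearMap := by
    rw [Submodule.span_le]
    rintro _ ⟨x, rfl⟩
    change G (pointEval x) - f.toFun x = 0
    by_cases hx : x ∈ ball (0 : E) 1
    · rw [toFun_ofFun hx, sub_self]
    · have : pointEval x = (0 : StrongDual ℂ (HInfty E)) := by
        ext f; simp [toFun_of_notMem f hx]
      rw [this, map_zero, toFun_of_notMem f hx, sub_self]
  have : ‖L ψ‖ ≤ 0 := by
    refine le_of_forall_pos_le_add fun ε hε => ?_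
    rw [zero_add]
    obtain ⟨χ, hχ, hχε⟩ := exists_mem_span_pointEval_norm_sub_le ψ.2
      (show 0 < ε / (‖L‖ + 1) by positivity)
    have h0 : L χ = 0 := hL hχ
    calc ‖L ψ‖ = ‖L (ψ - χ)‖ := by rw [map_sub, h0, sub_zero]
      _ ≤ ‖L‖ * (ε / (‖L‖ + 1)) := L.le_opNorm_of_le hχε
      _ ≤ (‖L‖ + 1) * (ε / (‖L‖ + 1)) := by gcongr; linarith
      _ = ε := by field_simp
  exact sub_eq_zero.1 (norm_le_zero_iff.1 this)

/-! ### Absence of strongly exposed points -/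

/-- A bounded linear functional as an element of `H^∞(B_E)`. -/
def ofDual (g : StrongDual ℂ E) : HInfty E :=
  ofFun g g.differentiable.differentiableOn ‖g‖ fun _ hx =>
    (g.le_opNorm _).trans (mul_le_of_le_one_right (norm_nonneg _) (mem_ball_zero_iff.1 hx).le)

theorem toFun_ofDual (g : StrongDual ℂ E) {x : E} (hx : x ∈ ball (0 : E) 1) :
    (ofDual g).toFun x = g x :=
  toFun_ofFun hx

theorem exists_smul_pointEval_ne [Nontrivial E] {a : ℂ} (ha : a ≠ 0) :
    ∃ y ∈ ball (0 : E) 1,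
      a • (pointEval y : StrongDual ℂ (HInfty E)) ≠ a • pointEval 0 := by
  obtain ⟨y, hy0, hy1⟩ := NormedField.exists_norm_lt_one ℂ
  obtain ⟨v, hv⟩ := exists_norm_eq E zero_le_one
  obtain ⟨g, -, hg⟩ := exists_dual_vector ℂ v (by simp [hv])
  have hmem : y • v ∈ ball (0 : E) 1 := by simpa [norm_smul, hv] using hy1
  refine ⟨y • v, hmem, fun h => ?_⟩
  have h1 : a * (ofDual g).toFun (y • v) = a * (ofDual g).toFun 0 :=
    DFunLike.congr_fun h (ofDual g)
  rw [toFun_ofDual g hmem, toFun_ofDual g (mem_ball_self zero_lt_one)] at h1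
  have hy : y ≠ 0 := norm_pos_iff.1 hy0
  simp [hg, hv, ha, hy] at h1

theorem not_isStronglyExposedPoint [Nontrivial E] (φ : GInfty E) :
    ¬ IsStronglyExposedPoint φ := by
  rintro ⟨hφ, F, hF, hFφ, hseq⟩
  obtain ⟨f, hf⟩ := exists_eq_apply F
  set δ : E → GInfty E := fun x => ⟨pointEval x, pointEval_mem_GInfty x⟩ with hδ
  have hδn (x : E) : ‖δ x‖ ≤ 1 := norm_pointEval_le x
  have hFδ (x : E) : F (δ x) = f.toFun x := hf _
  have hf1 : 1 ≤ ‖f‖ := by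
    have h1 := (φ : StrongDual ℂ (HInfty E)).le_opNorm f
    rw [← hf, hFφ, norm_one] at h1
    have h2 : ‖(φ : StrongDual ℂ (HInfty E))‖ = 1 := hφ
    rwa [h2, one_mul] at h1
  -- The phase that rotates `z` to `‖z‖`; it is 0 at 0 by the convention for division.
  set a : ℂ → ℂ := fun z => (starRingEnd ℂ) z / ‖z‖ with ha
  have ha1 (z : ℂ) : ‖a z‖ ≤ 1 := by
    simp only [ha, norm_div, RCLike.norm_conj, Complex.norm_real, norm_norm]
    exact div_self_le_one _
  have ha1' {z : ℂ} (hz : z ≠ 0) : ‖a z‖ = 1 := by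
    simp only [ha, norm_div, RCLike.norm_conj, Complex.norm_real, norm_norm]
    exact div_self (norm_ne_zero_iff.2 hz)
  have haz (z : ℂ) : a z * z = ‖z‖ := by
    rcases eq_or_ne z 0 with rfl | hz
    · simp
    · have : (‖z‖ : ℂ) ≠ 0 := by simpa using hz
      simp only [ha]
      rw [div_mul_eq_mul_div, Complex.conj_mul', div_eq_iff this, sq]
  set ρ : ℕ → ℝ := fun n => 1 - 1 / ((n : ℝ) + 1 + 1) with hρ
  have hρ0 (n : ℕ) : 0 ≤ ρ n := by
    simp only [hρ, sub_nonneg]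
    rw [div_le_one (by positivity)]
    linarith [Nat.cast_nonneg (α := ℝ) n]
  have hρ1 (n : ℕ) : ρ n < 1 := by
    simp only [hρ]
    have : 0 < 1 / ((n : ℝ) + 1 + 1) := by positivity
    linarith
  have hρt : Tendsto ρ atTop (𝓝 1) := by
    have := (tendsto_one_div_add_atTop_nhds_zero_nat (𝕜 := ℝ)).comp (tendsto_add_atTop_nat 1)
    have := (tendsto_const_nhds (x := (1 : ℝ))).sub this
    simpa [hρ, Function.comp_def] using this
  have key (x : ℕ → E) (hx : Tendsto (fun n => ‖f.toFun (x n)‖) atTop (𝓝 1)) :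
      Tendsto (fun n => ((ρ n : ℂ) * a (f.toFun (x n))) • δ (x n)) atTop (𝓝 φ) := by
    refine hseq _ (fun n => ?_) ?_
    · refine (mem_ball_zero_iff (E := ↥(GInfty E))).2 ?_
      change ‖((ρ n : ℂ) * a (f.toFun (x n))) •
        (pointEval (x n) : StrongDual ℂ (HInfty E))‖ < 1
      rw [norm_smul, norm_mul, Complex.norm_real, Real.norm_of_nonneg (hρ0 n)]
      calc _ ≤ ρ n * 1 * 1 := by
            gcongr
            · exact mul_nonneg (hρ0 n) zero_le_one
            · exact hρ0 n
            · exact ha1 _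
            · exact hδn _
        _ < 1 := by simpa using hρ1 n
    · have : Tendsto (fun n => ρ n * ‖f.toFun (x n)‖) atTop (𝓝 1) := by
        simpa using hρt.mul hx
      refine this.congr fun n => ?_
      rw [map_smul, hFδ, smul_eq_mul, mul_assoc, haz, ← Complex.ofReal_mul, Complex.ofReal_re]
  by_cases hmax : ∃ x ∈ ball (0 : E) 1, 1 ≤ ‖f.toFun x‖
  · obtain ⟨x, hx, hfx⟩ := hmax
    have hFn : ‖f‖ ≤ 1 := f.norm_le_of_forall zero_le_one fun y _ => by
      rw [← hFδ, ← hF]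
      exact (F.le_opNorm _).trans (mul_le_of_le_one_right (norm_nonneg _) (hδn y))
    have hc : ∀ y ∈ ball (0 : E) 1, f.toFun y = f.toFun x :=
      Complex.eqOn_of_isPreconnected_of_isMaxOn_norm (convex_ball 0 1).isPreconnected isOpen_ball
        f.differentiableOn_toFun hx fun y _ => (f.norm_toFun_le y).trans (hFn.trans hfx)
    have hfx1 : ‖f.toFun x‖ = 1 := le_antisymm ((f.norm_toFun_le x).trans hFn) hfx
    have hφy : ∀ y ∈ ball (0 : E) 1,
        a (f.toFun x) • (pointEval y : StrongDual ℂ (HInfty E)) = φ := by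
      intro y hy
      have h1 := key (fun _ => y) (by simp [hc y hy, hfx1])
      have h2 : Tendsto (fun n => ((ρ n : ℂ) * a (f.toFun y)) • δ y) atTop
          (𝓝 (((1 : ℝ) * a (f.toFun y) : ℂ) • δ y)) :=
        (((Complex.continuous_ofReal.tendsto _).comp hρt).mul_const _).smul_const _
      have h3 := congrArg Subtype.val (tendsto_nhds_unique h2 h1)
      rw [← h3, hc y hy]
      simp [hδ]
    have hane : a (f.toFun x) ≠ 0 := by
      rw [← norm_ne_zero_iff, ha1' (by rw [← norm_ne_zero_iff, hfx1]; exact one_ne_zero)]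
      exact one_ne_zero
    obtain ⟨y, hy, hne⟩ := exists_smul_pointEval_ne (E := E) hane
    exact hne ((hφy y hy).trans (hφy 0 (mem_ball_self zero_lt_one)).symm)
  · push Not at hmax
    have hex (n : ℕ) : ∃ x ∈ ball (0 : E) 1, ρ n < ‖f.toFun x‖ := by
      by_contra! h
      exact ((f.norm_le_of_forall (hρ0 n) h).trans_lt (hρ1 n)).not_ge hf1
    choose x hx hxρ using hex
    have hxt : Tendsto (fun n => ‖f.toFun (x n)‖) atTop (𝓝 1) :=
      tendsto_of_tendsto_of_tendsto_of_le_of_le hρt tendsto_const_nhds (fun n => (hxρ n).le)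
        fun n => (hmax _ (hx n)).le
    -- Norm convergence to `φ` allows testing on `f.npow k` for each fixed `k`.
    have hnorm (k : ℕ) : ‖(φ : StrongDual ℂ (HInfty E)) (f.npow k)‖ = 1 := by
      have h1 := (continuous_subtype_val.tendsto φ).comp (key x hxt)
      have h2 := ((ContinuousLinearMap.apply ℂ ℂ (f.npow k)).continuous.tendsto _).comp h1
      refine tendsto_nhds_unique h2.norm ?_
      have h3 : Tendsto (fun n => ρ n * ‖f.toFun (x n)‖ ^ k) atTop (𝓝 1) := by
        simpa using hρt.mul (hxt.pow k)
      refine h3.congr fun n => ?_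
      have hne : f.toFun (x n) ≠ 0 := norm_pos_iff.1 ((hρ0 n).trans_lt (hxρ n))
      change _ = ‖((ρ n : ℂ) * a (f.toFun (x n))) * (f.npow k).toFun (x n)‖
      rw [toFun_npow f k (hx n), norm_mul, norm_mul, ha1' hne, norm_pow, Complex.norm_real,
        Real.norm_of_nonneg (hρ0 n), mul_one]
    have h0 := (tendsto_apply_npow φ.2 hmax).norm
    simp only [hnorm, norm_zero] at h0
    exact one_ne_zero (tendsto_nhds_unique tendsto_const_nhds h0)

end HInfty
-- Ultrafilter limits, and contractions on `L¹` under the Radon–Nikodým property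
/-- A sequence of uniformly bounded bilinear maps has a pointwise limit along an ultrafilter. -/
theorem exists_tendsto_hyperfilter_bilinear {V W : Type*} [NormedAddCommGroup V]
    [NormedSpace ℂ V] [NormedAddCommGroup W] [NormedSpace ℂ W]
    (B : ℕ → V →L[ℂ] W →L[ℂ] ℂ) (hB : ∀ n, ‖B n‖ ≤ 1) :
    ∃ L : V →L[ℂ] W →L[ℂ] ℂ, ‖L‖ ≤ 1 ∧
      ∀ v w, Tendsto (fun n => B n v w) (hyperfilter ℕ : Filter ℕ) (𝓝 (L v w)) := by
  have hb (v : V) (w : W) (n : ℕ) : B n v w ∈ closedBall (0 : ℂ) (1 * ‖v‖ * ‖w‖) := by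
    rw [mem_closedBall_zero_iff]
    refine ((B n).le_opNorm₂ v w).trans ?_
    gcongr
    exact hB n
  have hlim (v : V) (w : W) : ∃ z ∈ closedBall (0 : ℂ) (1 * ‖v‖ * ‖w‖),
      Tendsto (fun n => B n v w) (hyperfilter ℕ : Filter ℕ) (𝓝 z) :=
    (isCompact_closedBall _ _).ultrafilter_le_nhds ((hyperfilter ℕ).map fun n => B n v w)
      (tendsto_principal.2 (Eventually.of_forall (hb v w)))
  choose ℓ hℓ hℓt using hlim
  refine ⟨LinearMap.mkContinuous₂ (LinearMap.mk₂ ℂ ℓ ?_ ?_ ?_ ?_) 1 ?_, ?_, hℓt⟩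
  · intro v v' w
    exact tendsto_nhds_unique (hℓt _ _)
      (by simpa using (hℓt v w).add (hℓt v' w))
  · intro c v w
    exact tendsto_nhds_unique (hℓt _ _) (by simpa using (hℓt v w).const_mul c)
  · intro v w w'
    exact tendsto_nhds_unique (hℓt _ _)
      (by simpa using (hℓt v w).add (hℓt v w'))
  · intro c v w
    exact tendsto_nhds_unique (hℓt _ _) (by simpa using (hℓt v w).const_mul c)
  · exact fun v w => mem_closedBall_zero_iff.1 (hℓ v w)
  · exact LinearMap.mkContinuous₂_norm_le _ zero_le_one _

theorem enorm_apply_indicatorConstLp_le {Ω X : Type*} [MeasurableSpace Ω] (μ : Measure Ω)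
    [IsFiniteMeasure μ] [NormedAddCommGroup X] [NormedSpace ℂ X] (S : Lp ℂ 1 μ →L[ℂ] X)
    (hS : ∀ h, ‖S h‖ ≤ ‖h‖) {A : Set Ω} (hA : MeasurableSet A) :
    ‖S (indicatorConstLp 1 hA (measure_ne_top μ A) 1)‖ₑ ≤ μ A := by
  refine (enorm_le_iff_norm_le.2 (hS _)).trans ?_
  simpa using enorm_indicatorConstLp_le (p := 1) (hs := hA)
    (hμs := measure_ne_top μ A) (c := (1 : ℂ))

/-- The vector measure `A ↦ S 1_A` defined by a contraction `S` on `L¹(μ)`. -/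
def contractionVectorMeasure {Ω X : Type*} [MeasurableSpace Ω] (μ : Measure Ω) [IsFiniteMeasure μ]
    [NormedAddCommGroup X] [NormedSpace ℂ X] [CompleteSpace X] (S : Lp ℂ 1 μ →L[ℂ] X)
    (hS : ∀ h, ‖S h‖ ≤ ‖h‖) : VectorMeasure Ω X :=
  open Classical in
  VectorMeasure.of_additive_of_le_measure (μ := μ)
    (fun A => if hA : MeasurableSet A then S (indicatorConstLp 1 hA (measure_ne_top μ A) 1) else 0)
    (fun A => by
      split_ifs with hA
      · exact enorm_apply_indicatorConstLp_le μ S hS hA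
      · simp)
    (fun A B hA hB hAB => by
      rw [dif_pos hA, dif_pos hB, dif_pos (hA.union hB), ← map_add,
        indicatorConstLp_disjoint_union hA hB _ _ hAB])
    (fun A hA => dif_neg hA)

theorem contractionVectorMeasure_apply {Ω X : Type*} [MeasurableSpace Ω] (μ : Measure Ω)
    [IsFiniteMeasure μ] [NormedAddCommGroup X] [NormedSpace ℂ X] [CompleteSpace X]
    (S : Lp ℂ 1 μ →L[ℂ] X) (hS : ∀ h, ‖S h‖ ≤ ‖h‖) {A : Set Ω} (hA : MeasurableSet A) :
    contractionVectorMeasure μ S hS A = S (indicatorConstLp 1 hA (measure_ne_top μ A) 1) :=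
  dif_pos hA

theorem enorm_contractionVectorMeasure_le {Ω X : Type*} [MeasurableSpace Ω] (μ : Measure Ω)
    [IsFiniteMeasure μ] [NormedAddCommGroup X] [NormedSpace ℂ X] [CompleteSpace X]
    (S : Lp ℂ 1 μ →L[ℂ] X) (hS : ∀ h, ‖S h‖ ≤ ‖h‖) {A : Set Ω} (hA : MeasurableSet A) :
    ‖contractionVectorMeasure μ S hS A‖ₑ ≤ μ A := by
  rw [contractionVectorMeasure_apply μ S hS hA]
  exact enorm_apply_indicatorConstLp_le μ S hS hA

/-- The measure `A ↦ S 1_A` is dominated in norm by `μ`, which gives both bounded variation and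
absolute continuity. -/
theorem HasRadonNikodymProperty.exists_density {Ω : Type} {X : Type*} [MeasurableSpace Ω]
    {μ : Measure Ω} [IsFiniteMeasure μ] [NormedAddCommGroup X] [NormedSpace ℂ X] [CompleteSpace X]
    (hX : HasRadonNikodymProperty X) (S : Lp ℂ 1 μ →L[ℂ] X) (hS : ∀ h, ‖S h‖ ≤ ‖h‖) :
    ∃ g : Ω → X, Integrable g μ ∧ ∀ A : Set Ω, ∀ hA : MeasurableSet A,
      S (indicatorConstLp 1 hA (measure_ne_top μ A) 1) = ∫ ω in A, g ω ∂μ := by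
  have hvar : (contractionVectorMeasure μ S hS).variation Set.univ < ⊤ :=
    lt_of_le_of_lt (VectorMeasure.variation_le_of_forall_enorm_le
      (fun A hA => enorm_contractionVectorMeasure_le μ S hS hA) _) (measure_lt_top μ Set.univ)
  have hac : VectorMeasure.AbsolutelyContinuous (contractionVectorMeasure μ S hS)
      μ.toENNRealVectorMeasure := by
    intro A hA
    by_cases hmeas : MeasurableSet A
    · rw [Measure.toENNRealVectorMeasure_apply_measurable hmeas] at hA
      have := enorm_contractionVectorMeasure_le μ S hS hmeas
      rwa [hA, nonpos_iff_eq_zero, enorm_eq_zero] at this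
    · exact VectorMeasure.not_measurable _ hmeas
  obtain ⟨g, hg, h⟩ := hX Ω μ (contractionVectorMeasure μ S hS) hvar hac
  exact ⟨g, hg, fun A hA => (contractionVectorMeasure_apply μ S hS hA).symm.trans (h A hA)⟩

/-- If a space has the Radon–Nikodým property, the values of the density of a contraction
`S` on `L¹(μ)` represent `S` weakly. -/
theorem HasRadonNikodymProperty.exists_ae_eq {Ω : Type} {X : Type*} [MeasurableSpace Ω]
    {μ : Measure Ω} [IsFiniteMeasure μ] [NormedAddCommGroup X] [NormedSpace ℂ X] [CompleteSpace X]
    (hX : HasRadonNikodymProperty X) (S : Lp ℂ 1 μ →L[ℂ] X) (hS : ∀ h, ‖S h‖ ≤ ‖h‖) :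
    ∃ g : Ω → X, ∀ (F : StrongDual ℂ X) (k : Ω → ℂ), Integrable k μ →
      (∀ A, ∀ hA : MeasurableSet A,
        F (S (indicatorConstLp 1 hA (measure_ne_top μ A) 1)) = ∫ ω in A, k ω ∂μ) →
      ∀ᵐ ω ∂μ, F (g ω) = k ω := by
  obtain ⟨g, hg, h⟩ := hX.exists_density S hS
  refine ⟨g, fun F k hk hF => ?_⟩
  refine Integrable.ae_eq_of_forall_setIntegral_eq _ _ (F.integrable_comp hg) hk fun A hA _ => ?_
  rw [← hF A hA, h A hA]
  exact F.integral_comp_comm hg.integrableOn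

/-! ### Circle averages and their limit at the boundary -/

/-- The point `r e^{it} v`. -/
def circlePoint {E : Type*} [NormedAddCommGroup E] [NormedSpace ℂ E] (v : E) (r : ℝ)
    (t : AddCircle (2 * Real.pi)) : E :=
  ((r : ℂ) * (AddCircle.toCircle t : ℂ)) • v

local instance : Fact (0 < 2 * Real.pi) := ⟨Real.two_pi_pos⟩

namespace HInfty

open AddCircle

variable {E : Type*} [NormedAddCommGroup E] [NormedSpace ℂ E]

theorem continuous_circlePoint (v : E) (r : ℝ) : Continuous (circlePoint v r) := by
  unfold circlePoint
  exact (continuous_const.mul (continuous_subtype_val.comp AddCircle.continuous_toCircle)).smul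
    continuous_const

theorem smul_mem_ball {v : E} (hv : ‖v‖ = 1) {z : ℂ} (hz : ‖z‖ < 1) :
    z • v ∈ ball (0 : E) 1 := by
  rwa [mem_ball_zero_iff, norm_smul, hv, mul_one]

theorem circlePoint_mem_ball {v : E} (hv : ‖v‖ = 1) {r : ℝ} (hr : r ∈ Set.Ioo (0 : ℝ) 1)
    (t : AddCircle (2 * Real.pi)) : circlePoint v r t ∈ ball (0 : E) 1 :=
  smul_mem_ball hv (by
    rw [norm_mul, Circle.norm_coe, mul_one, Complex.norm_real, Real.norm_of_nonneg hr.1.le]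
    exact hr.2)

theorem continuous_toFun_circlePoint (f : HInfty E) {v : E} (hv : ‖v‖ = 1) {r : ℝ}
    (hr : r ∈ Set.Ioo (0 : ℝ) 1) : Continuous fun t => f.toFun (circlePoint v r t) :=
  f.differentiableOn_toFun.continuousOn.comp_continuous (continuous_circlePoint v r)
    (circlePoint_mem_ball hv hr)

theorem integrable_toFun_circlePoint_mul (f : HInfty E) {v : E} (hv : ‖v‖ = 1) {r : ℝ}
    (hr : r ∈ Set.Ioo (0 : ℝ) 1) (h : Lp ℂ 1 (haarAddCircle (T := 2 * Real.pi))) :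
    Integrable (fun t => f.toFun (circlePoint v r t) * h t) haarAddCircle :=
  (L1.integrable_coeFn h).bdd_mul (c := ‖f‖)
    (f.continuous_toFun_circlePoint hv hr).aestronglyMeasurable
    (Eventually.of_forall fun _ => f.norm_toFun_le _)

/-- Integration of a bounded holomorphic function over the circle of radius `r` in the
direction `v`, against an integrable density. -/
def circleFunctional {v : E} (hv : ‖v‖ = 1) {r : ℝ} (hr : r ∈ Set.Ioo (0 : ℝ) 1) :
    Lp ℂ 1 (haarAddCircle (T := 2 * Real.pi)) →L[ℂ] HInfty E →L[ℂ] ℂ :=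
  LinearMap.mkContinuous₂
    (LinearMap.mk₂ ℂ (fun h f => ∫ t, f.toFun (circlePoint v r t) * h t ∂haarAddCircle)
      (fun h k f => by
        rw [← integral_add (f.integrable_toFun_circlePoint_mul hv hr h)
          (f.integrable_toFun_circlePoint_mul hv hr k)]
        refine integral_congr_ae ?_
        filter_upwards [Lp.coeFn_add h k] with t ht
        rw [ht, Pi.add_apply, mul_add])
      (fun c h f => by
        rw [← integral_smul]
        refine integral_congr_ae ?_
        filter_upwards [Lp.coeFn_smul c h] with t ht
        rw [ht, Pi.smul_apply, smul_eq_mul, smul_eq_mul, mul_left_comm])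
      (fun h f g => by
        rw [← integral_add (f.integrable_toFun_circlePoint_mul hv hr h)
          (g.integrable_toFun_circlePoint_mul hv hr h)]
        simp only [toFun_add, add_mul])
      (fun c h f => by
        rw [← integral_smul]
        simp only [toFun_smul, smul_eq_mul, mul_assoc]))
    1 fun h f => by
      rw [one_mul, L1.norm_eq_integral_norm, ← integral_mul_const]
      refine (norm_integral_le_integral_norm _).trans ?_
      refine integral_mono (f.integrable_toFun_circlePoint_mul hv hr h).norm
        ((L1.integrable_coeFn h).norm.mul_const _) fun t => ?_
      simp only [norm_mul]
      exact (mul_le_mul_of_nonneg_right (f.norm_toFun_le _) (norm_nonneg _)).trans_eq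
        (mul_comm _ _)

theorem circleFunctional_apply {v : E} (hv : ‖v‖ = 1) {r : ℝ} (hr : r ∈ Set.Ioo (0 : ℝ) 1)
    (h : Lp ℂ 1 (haarAddCircle (T := 2 * Real.pi))) (f : HInfty E) :
    circleFunctional hv hr h f = ∫ t, f.toFun (circlePoint v r t) * h t ∂haarAddCircle := rfl

theorem norm_circleFunctional_le {v : E} (hv : ‖v‖ = 1) {r : ℝ} (hr : r ∈ Set.Ioo (0 : ℝ) 1) :
    ‖circleFunctional hv hr‖ ≤ 1 :=
  LinearMap.mkContinuous₂_norm_le _ zero_le_one _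

theorem circleFunctional_fourierLp {v : E} (hv : ‖v‖ = 1) {r : ℝ} (hr : r ∈ Set.Ioo (0 : ℝ) 1)
    (k : ℤ) (f : HInfty E) :
    circleFunctional hv hr (fourierLp 1 k) f =
      ∫ t, f.toFun (circlePoint v r t) * fourier k t ∂haarAddCircle := by
  rw [circleFunctional_apply]
  refine integral_congr_ae ?_
  filter_upwards [coeFn_fourierLp 1 k] with t ht
  rw [ht]

/-- The circle of radius `r < 1` is compact in the ball and the character is continuous, so the
integral is compact-open continuous in `f`. -/
theorem circleFunctional_fourierLp_mem_GInfty {v : E} (hv : ‖v‖ = 1) {r : ℝ}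
    (hr : r ∈ Set.Ioo (0 : ℝ) 1) (k : ℤ) : circleFunctional hv hr (fourierLp 1 k) ∈ GInfty E := by
  set γ : C(AddCircle (2 * Real.pi), ↥(ball (0 : E) 1)) :=
    ⟨fun t => ⟨circlePoint v r t, circlePoint_mem_ball hv hr t⟩,
      (continuous_circlePoint v r).subtype_mk _⟩
  have h1 : Continuous fun g : C(↥(ball (0 : E) 1), ℂ) =>
      ∫ t, (g.comp γ * fourier k : C(AddCircle (2 * Real.pi), ℂ)) t ∂haarAddCircle := by
    have h2 : Continuous fun g : C(↥(ball (0 : E) 1), ℂ) =>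
        (g.comp γ * fourier k : C(AddCircle (2 * Real.pi), ℂ)) :=
      (ContinuousMap.continuous_precomp γ).mul continuous_const
    have h3 : Continuous fun u : C(AddCircle (2 * Real.pi), ℂ) =>
        ∫ t, u t ∂haarAddCircle := by
      refine (continuous_congr fun u => ?_).1 (continuous_integral.comp
        (ContinuousMap.toLp (E := ℂ) 1 (haarAddCircle (T := 2 * Real.pi)) ℂ).continuous)
      exact integral_congr_ae (ContinuousMap.coeFn_toLp haarAddCircle u)
    exact h3.comp h2
  have h4 := @Continuous.comp _ _ _ (compactOpenTopology E) _ _ _ _ h1 continuous_induced_dom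
  refine @Continuous.continuousOn _ _ (compactOpenTopology E) _ _ _ ?_
  have : (fun f => circleFunctional hv hr (fourierLp 1 k) f) =
      (fun g : C(↥(ball (0 : E) 1), ℂ) => ∫ t, (g.comp γ * fourier k : C(AddCircle (2 * Real.pi), ℂ)) t ∂haarAddCircle) ∘
        toContinuousMap := by
    funext f
    rw [circleFunctional_fourierLp]
    refine integral_congr_ae (Eventually.of_forall fun t => ?_)
    change _ = f.toContinuousMap (γ t) * fourier k t
    rw [toContinuousMap_apply]
    rfl
  rw [this]
  exact h4

theorem circleIntegral_eq_circleFunctional (f : HInfty E) {v : E} (hv : ‖v‖ = 1) {r : ℝ}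
    (hr : r ∈ Set.Ioo (0 : ℝ) 1) (k : ℤ) :
    (∮ z in C(0, r), (z - 0)⁻¹ • (z ^ k * f.toFun (z • v))) =
      2 * Real.pi * Complex.I * (r ^ k * circleFunctional hv hr (fourierLp 1 k) f) := by
  -- Fourier coefficients integrate against `fourier (-n)`, hence the index `-k`.
  have h1 := fourierCoeff_eq_intervalIntegral
    (fun t : AddCircle (2 * Real.pi) => f.toFun (circlePoint v r t)) (-k) 0
  rw [fourierCoeff, neg_neg, zero_add] at h1
  have h2 := (circleFunctional_fourierLp hv hr k f).trans
    ((integral_congr_ae (Eventually.of_forall fun t => mul_comm _ _)).trans h1)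
  have hr0 : (r : ℂ) ≠ 0 := by exact_mod_cast hr.1.ne'
  have h3 : (∮ z in C(0, r), (z - 0)⁻¹ • (z ^ k * f.toFun (z • v))) =
      Complex.I * r ^ k * ∫ x in (0 : ℝ)..2 * Real.pi,
        (fourier k (x : AddCircle (2 * Real.pi)) : ℂ) • f.toFun (circlePoint v r x) := by
    rw [circleIntegral, ← intervalIntegral.integral_const_mul]
    refine intervalIntegral.integral_congr fun θ _ => ?_
    have h4 : circleMap 0 r θ = r * (toCircle (θ : AddCircle (2 * Real.pi)) : ℂ) := by
      rw [circleMap_zero, toCircle_apply_mk, Circle.coe_exp]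
      congr 3
      push_cast
      field_simp
    have h5 : circleMap 0 r θ ≠ 0 := circleMap_ne_center hr.1.ne'
    have h6 : (fourier k (θ : AddCircle (2 * Real.pi)) : ℂ) =
        (toCircle (θ : AddCircle (2 * Real.pi)) : ℂ) ^ k := by
      rw [fourier_apply, toCircle_zsmul, Circle.coe_zpow]
    simp only [deriv_circleMap, sub_zero, smul_eq_mul]
    rw [h6, circlePoint, ← h4]
    have h7 : circleMap 0 r θ ^ k = r ^ k *
        (toCircle (θ : AddCircle (2 * Real.pi)) : ℂ) ^ k := by rw [h4, mul_zpow]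
    rw [h7]
    field_simp
  rw [h3, h2, Complex.real_smul]
  push_cast
  have : (Real.pi : ℂ) ≠ 0 := by exact_mod_cast Real.pi_ne_zero
  field_simp

/-- Cauchy's theorem for `z ^ k * f (z • v) / z`. Since `k` may be negative, it is applied on an
annulus avoiding 0. -/
theorem zpow_mul_circleFunctional_eq (f : HInfty E) {v : E} (hv : ‖v‖ = 1) {r s : ℝ}
    (hr : r ∈ Set.Ioo (0 : ℝ) 1) (hs : s ∈ Set.Ioo (0 : ℝ) 1) (hrs : r ≤ s) (k : ℤ) :
    (s : ℂ) ^ k * circleFunctional hv hs (fourierLp 1 k) f =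
      r ^ k * circleFunctional hv hr (fourierLp 1 k) f := by
  have hd : ∀ z ∈ closedBall (0 : ℂ) s \ ball 0 r,
      DifferentiableAt ℂ (fun z : ℂ => z ^ k * f.toFun (z • v)) z := by
    rintro z ⟨hz1, hz2⟩
    rw [mem_closedBall_zero_iff] at hz1
    rw [mem_ball_zero_iff, not_lt] at hz2
    have hz0 : z ≠ 0 := norm_pos_iff.1 (hr.1.trans_le hz2)
    have h1 : DifferentiableAt ℂ f.toFun (z • v) :=
      f.differentiableAt_toFun (smul_mem_ball hv (hz1.trans_lt hs.2))
    exact (differentiableAt_zpow.2 (Or.inl hz0)).mul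
      (h1.comp (f := fun z : ℂ => z • v) z (differentiableAt_id.smul_const v))
  have h := Complex.circleIntegral_sub_center_inv_smul_eq_of_differentiable_on_annulus_off_countable
    hr.1 hrs Set.countable_empty
    (fun z hz => (hd z hz).continuousAt.continuousWithinAt)
    (fun z hz => hd z ⟨ball_subset_closedBall hz.1.1, fun h => hz.1.2 (ball_subset_closedBall h)⟩)
  rw [f.circleIntegral_eq_circleFunctional hv hr, f.circleIntegral_eq_circleFunctional hv hs] at h
  exact mul_left_cancel₀ Complex.two_pi_I_ne_zero h

/-- Integration of boundary values: the limit of the circle functionals as the radius tends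
to `1`. -/
theorem exists_boundaryFunctional {v : E} (hv : ‖v‖ = 1) (g : StrongDual ℂ E)
    (hg : g v = 1) :
    ∃ S : Lp ℂ 1 (haarAddCircle (T := 2 * Real.pi)) →L[ℂ] GInfty E,
      (∀ h, ‖S h‖ ≤ ‖h‖) ∧
      ∀ h (n : ℕ), (S h : StrongDual ℂ (HInfty E)) ((ofDual g).npow n) =
        ∫ t, fourier n t * h t ∂haarAddCircle := by
  -- The double shift gives `r 0 = 1/2`, a positive reference radius.
  set r : ℕ → ℝ := fun n => 1 - 1 / ((n : ℝ) + 1 + 1) with hrdef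
  have hr (n : ℕ) : r n ∈ Set.Ioo (0 : ℝ) 1 := by
    have h1 : 1 / ((n : ℝ) + 1 + 1) < 1 := by
      rw [div_lt_one (by positivity)]
      linarith [Nat.cast_nonneg (α := ℝ) n]
    have h2 : 0 < 1 / ((n : ℝ) + 1 + 1) := by positivity
    constructor <;> simp only [hrdef] <;> linarith
  have hrmono (n : ℕ) : r 0 ≤ r n := by
    simp only [hrdef]
    gcongr
    exact Nat.zero_le n
  have hrt : Tendsto (fun n => (r n : ℂ)) (hyperfilter ℕ : Filter ℕ) (𝓝 1) := by
    have := (tendsto_one_div_add_atTop_nhds_zero_nat (𝕜 := ℝ)).comp (tendsto_add_atTop_nat 1)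
    have := (tendsto_const_nhds (x := (1 : ℝ))).sub this
    have h1 : Tendsto r atTop (𝓝 1) := by simpa [hrdef, Function.comp_def] using this
    have h2 := ((Complex.continuous_ofReal.tendsto _).comp h1).mono_left
      (Nat.cofinite_eq_atTop ▸ hyperfilter_le_cofinite)
    simpa [Function.comp_def] using h2
  obtain ⟨L, hL, hLt⟩ := exists_tendsto_hyperfilter_bilinear
    (fun n => circleFunctional hv (hr n)) fun n => norm_circleFunctional_le hv (hr n)
  -- By Cauchy, `r n ^ k` times the average does not depend on `n`. As `r n ^ k → 1`, the limit is a
  -- multiple of the average at radius `r 0`, so it stays in `G^∞(E)`; density of trigonometric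
  -- polynomials and closedness do the rest.
  have hfourier (k : ℤ) : L (fourierLp 1 k) ∈ GInfty E := by
    have h1 : L (fourierLp 1 k) =
        ((r 0 : ℂ) ^ k) • circleFunctional hv (hr 0) (fourierLp 1 k) := by
      ext f
      have h2 : Tendsto (fun n => (r n : ℂ) ^ k) (hyperfilter ℕ : Filter ℕ) (𝓝 1) := by
        have h3 : ContinuousAt (fun z : ℂ => z ^ k) 1 :=
          continuousAt_zpow₀ _ _ (Or.inl one_ne_zero)
        have := h3.tendsto.comp hrt
        rwa [one_zpow] at this
      have h4 := h2.mul (hLt (fourierLp 1 k) f)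
      rw [one_mul] at h4
      refine tendsto_nhds_unique h4 (tendsto_const_nhds.congr fun n => ?_)
      exact (f.zpow_mul_circleFunctional_eq hv (hr 0) (hr n) (hrmono n) k).symm
    rw [h1]
    exact Submodule.smul_mem _ _ (circleFunctional_fourierLp_mem_GInfty hv (hr 0) k)
  have hmem (h) : L h ∈ GInfty E := by
    have hcl : IsClosed (L ⁻¹' (GInfty E : Set (StrongDual ℂ (HInfty E)))) :=
      (isClosed_GInfty E).preimage L.continuous
    have hspan : Submodule.span ℂ (Set.range (fourierLp (T := 2 * Real.pi) 1)) ≤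
        (GInfty E).comap L.toLinearMap :=
      Submodule.span_le.2 (by rintro _ ⟨k, rfl⟩; exact hfourier k)
    have := Submodule.topologicalClosure_minimal _ hspan hcl
    rw [span_fourierLp_closure_eq_top ENNReal.one_ne_top] at this
    exact this (Submodule.mem_top (x := h))
  refine ⟨L.codRestrict (GInfty E) hmem, fun h => ?_, fun h n => ?_⟩
  · exact (L.le_of_opNorm_le hL h).trans_eq (one_mul _)
  · refine tendsto_nhds_unique (hLt h ((ofDual g).npow n)) ?_
    have h1 : Tendsto (fun j => (r j : ℂ) ^ n * ∫ t, fourier n t * h t ∂haarAddCircle)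
        (hyperfilter ℕ : Filter ℕ) (𝓝 (∫ t, fourier n t * h t ∂haarAddCircle)) := by
      simpa using (hrt.pow n).mul_const (∫ t, fourier n t * h t ∂haarAddCircle)
    refine h1.congr fun j => ?_
    rw [circleFunctional_apply, ← integral_const_mul]
    refine integral_congr_ae (Eventually.of_forall fun t => ?_)
    have hb := circlePoint_mem_ball hv (hr j) t
    simp only
    rw [toFun_npow _ _ hb, toFun_ofDual g hb, circlePoint, map_smul, hg, smul_eq_mul, mul_one,
      mul_pow, fourier_apply, natCast_zsmul, toCircle_nsmul, Circle.coe_pow, mul_assoc]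

theorem not_hasRadonNikodymProperty [Nontrivial E] : ¬ HasRadonNikodymProperty (GInfty E) := by
  intro hRN
  obtain ⟨v, hv⟩ := exists_norm_eq E zero_le_one
  obtain ⟨g, hg1, hg⟩ := exists_dual_vector ℂ v (by simp [hv])
  rw [hv] at hg
  obtain ⟨S, hS, hSg⟩ := exists_boundaryFunctional hv g (by simpa using hg)
  obtain ⟨d, hd⟩ := HasRadonNikodymProperty.exists_ae_eq (X := GInfty E)
    (μ := haarAddCircle (T := 2 * Real.pi)) hRN S hS
  -- Only countably many powers are tested, so a single `t` serves all `n`.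
  have h1 : ∀ᵐ t ∂haarAddCircle, ∀ n : ℕ,
      (d t : StrongDual ℂ (HInfty E)) ((ofDual g).npow n) = fourier n t := by
    refine ae_all_iff.2 fun n => ?_
    refine hd ((ContinuousLinearMap.apply ℂ ℂ ((ofDual g).npow n)).comp (GInfty E).subtypeL)
      (fourier n) ((fourier n).continuous.integrable_of_hasCompactSupport
        (HasCompactSupport.of_compactSpace _)) fun A hA => ?_
    refine (hSg _ n).trans ?_
    rw [← integral_indicator hA]
    refine integral_congr_ae ?_
    filter_upwards [indicatorConstLp_coeFn (p := 1) (hs := hA)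
      (hμs := measure_ne_top haarAddCircle A) (c := (1 : ℂ))] with t ht
    rw [ht]
    by_cases hmem : t ∈ A <;> simp [hmem]
  obtain ⟨t, ht⟩ := h1.exists
  have hlt : ∀ x ∈ ball (0 : E) 1, ‖(ofDual g).toFun x‖ < 1 := fun x hx => by
    rw [toFun_ofDual g hx]
    exact (g.le_of_opNorm_le hg1.le x).trans_lt (by simpa using hx)
  have h2 := (tendsto_apply_npow (d t).2 hlt).norm
  simp only [ht, norm_zero, fourier_apply, Circle.norm_coe] at h2
  exact one_ne_zero (tendsto_nhds_unique tendsto_const_nhds h2)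

end HInfty

end

theorem corollary2p2 (E : Type*) [NormedAddCommGroup E] [NormedSpace ℂ E] [CompleteSpace E]
    [Nontrivial E] :
    (¬ ∃ φ : GInfty E, IsStronglyExposedPoint φ) ∧ ¬ HasRadonNikodymProperty (GInfty E) :=
  ⟨fun ⟨φ, hφ⟩ => HInfty.not_isStronglyExposedPoint φ hφ, HInfty.not_hasRadonNikodymProperty⟩
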